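/- An environment is a function $\omega:\mathbb Z\to[0,1]$. For $x\in\mathbb Z$, the random walk in $\omega$ started at $x$ is the Markov chain $(X_n)_{n\ge 0}$ on $\mathbb Z$ with $X_0=x$ that steps from $z$ to $z+1$ with probability $\omega(z)$ and to $z-1$ with probability $1-\omega(z)$; its law is denoted $\mathbf P^x_\omega$. For $\frac12<p\le 1$ and $0\le\lambda\le 1$, a $(p,\lambda)$ environment is an environment $\omega$ such that $\omega(x)\in\{\frac12,p\}$ for every $x\in\mathbb Z$ and $$\limsup_{n\to\infty}\frac1{n+1}\sum_{x=0}^{n}\mathbf 1_{\omega(x)=p}=\lambda .$$ We say that $\omega$ has spaced drifts of density $\lambda$ if $$\{x\in\mathbb Z:\omega(x)=p\}=\Big\{\Big\lceil \tfrac1\lambda\Big(i+\tfrac{1-p}{2p-1}\Big)\Big\rceil : i\in\mathbb Z\Big\}.$$ We say that $\omega$ has speed $v\in\mathbb R$ if, for every $x\in\mathbb Z$, $\lim_{n\to\infty}X_n/n=v$ holds $\mathbf P^x_\omega$-almost surely. **Proposition.** For every $\frac12<p\le1$ there is a constant $D=D(p)>0$, depending only on $p$, such that for every $0<\lambda\le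 1$ the following hold. 1. There is a $(p,\lambda)$ environment $\omega$ which has a speed $v$ with $v\ge(2p-1)\lambda-D\lambda^3$. If $\lambda$ is rational, $\omega$ can moreover be chosen with spaced drifts of density $\lambda$. 2. If $\lambda$ is irrational, there is $\varepsilon>0$ such that for every rational $\lambda'>0$ with $\lambda-\varepsilon<\lambda'<\lambda$ there is a $(p,\lambda')$ environment with spaced drifts of density $\lambda'$ which has a speed $v$ with $v\ge(2p-1)\lambda-D\lambda^3$. -/

import Mathlib

open MeasureTheory ProbabilityTheory Filter Topology

noncomputable section

/-- A nearest-neighbour environment on the integers: `ω z` is the probability of a step to the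
right from `z`. -/
abbrev Environment : Type := ℤ → unitInterval

/-- `ω` is a `(p, lam)` environment: it takes only the values `1/2` and `p`, and the upper density
of the drift points (the sites with value `p`) on the nonnegative half line is exactly `lam`. -/
structure IsEnvironment (p lam : ℝ) (ω : Environment) : Prop where
  values : ∀ x : ℤ, (ω x : ℝ) = 1 / 2 ∨ (ω x : ℝ) = p
  density : limsup (fun n : ℕ =>
    (1 / ((n : ℝ) + 1)) * ∑ x ∈ Finset.range (n + 1),
      Set.indicator {y : ℤ | (ω y : ℝ) = p} (fun _ => (1 : ℝ)) (x : ℤ)) atTop = lam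

/-- The drift points of `ω` are exactly the sites `⌈(i + (1 - p) / (2 p - 1)) / lam⌉`, `i ∈ ℤ`. -/
def HasSpacedDrifts (p lam : ℝ) (ω : Environment) : Prop :=
  ∀ x : ℤ, (ω x : ℝ) = p ↔ ∃ i : ℤ, x = ⌈((i : ℝ) + (1 - p) / (2 * p - 1)) / lam⌉

/-- The law of one step from `z`: to `z + 1` with probability `ω z`, to `z - 1` with probability
`1 - ω z`. -/
def stepMeasure (ω : Environment) (z : ℤ) : Measure ℤ :=
  ENNReal.ofReal (ω z) • Measure.dirac (z + 1) + ENNReal.ofReal (1 - ω z) • Measure.dirac (z - 1)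

instance (ω : Environment) (z : ℤ) : IsProbabilityMeasure (stepMeasure ω z) := by
  refine ⟨?_⟩
  have h0 : (0 : ℝ) ≤ ω z := (ω z).2.1
  have h1 : (0 : ℝ) ≤ 1 - ω z := sub_nonneg.2 (ω z).2.2
  simp [stepMeasure, ← ENNReal.ofReal_add h0 h1]

/-- The transition kernel at time `n`, as a function of the path up to time `n`; it depends on the
current position only. -/
def walkKernel (ω : Environment) (n : ℕ) : Kernel (Finset.Iic n → ℤ) ℤ :=
  Kernel.ofFunOfCountable fun a => stepMeasure ω (a ⟨n, Finset.mem_Iic.2 le_rfl⟩)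

instance (ω : Environment) (n : ℕ) : IsMarkovKernel (walkKernel ω n) :=
  ⟨fun a => inferInstanceAs
    (IsProbabilityMeasure (stepMeasure ω (a ⟨n, Finset.mem_Iic.2 le_rfl⟩)))⟩

/-- The law, on the space of paths `ℕ → ℤ`, of the random walk in the environment `ω` started
at `x`. -/
def walkLaw (ω : Environment) (x : ℤ) : Measure (ℕ → ℤ) :=
  Kernel.trajMeasure (X := fun _ : ℕ => ℤ) (Measure.dirac x) (walkKernel ω)

/-- The random walk in the environment `ω` has speed `v`: for every starting point, almost surely
`X n / n` converges to `v`. -/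
def HasSpeed (ω : Environment) (v : ℝ) : Prop :=
  ∀ x : ℤ, ∀ᵐ X ∂(walkLaw ω x), Tendsto (fun n : ℕ => (X n : ℝ) / (n : ℝ)) atTop (𝓝 v)

end

/-! Suppose `h` is monotone and Lipschitz, and its expected value after one step from `z` is `h z +
1`. Then `h (X n) - n` is a martingale with bounded increments, so fourth moments give `h (X n) / n
→ 1` almost surely. If `h z / z → κ > 0` at `+∞`, the speed is `κ⁻¹` (`hasSpeed_of_corrector`).

Such an `h` is explicit. Let `u i` be the gaps between consecutive drift points and `r = (1 - p) /
p`. The slope of `h` rises by 2 at each fair site and obeys an affine recursion of ratio `r` at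
drift points. Hence `h` grows over the gap `i` by `u i ^ 2 + 2 ∑ r ^ (k + 1) u i u (i - 1 - k)`. If
the gaps have mean `L` and correlations `c k`, the speed is `L / (c 0 + 2 ∑ r ^ (k + 1) c (k + 1))`
(`hasSpeed_of_gap_correlations`).

When every gap is within 1 of `L`, averaging `(u i - L) * (u (i - k) - L) ≤ 1` gives `c k ≤ L ^ 2 +
1`. As `1 + 2 ∑ r ^ (k + 1) = 1 / (2 p - 1)`, the speed is at least `(2 p - 1) L / (L ^ 2 + 1)`, and
`L = 1 / lam` makes the loss cubic in `lam` (`exists_hasSpeed_ge`).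

It remains to find sequences whose correlations exist. For rational density the spaced drifts have
periodic gaps. For irrational density the gaps `m` and `m + 1` are arranged in such long runs that
all correlations coincide. The second claim uses the rational case at `q`, with `q` so close to
`lam` that the loss is again cubic. -/

/-! ### One-step law of the walk and moment bounds for centred increments. -/

lemma lintegral_stepMeasure (ω : Environment) (z : ℤ) (f : ℤ → ENNReal) :
    ∫⁻ y, f y ∂(stepMeasure ω z) =
      ENNReal.ofReal (ω z) * f (z + 1) + ENNReal.ofReal (1 - ω z) * f (z - 1) := by
  simp [stepMeasure, lintegral_add_measure]

instance (ω : Environment) (x : ℤ) : IsProbabilityMeasure (walkLaw ω x) := by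
  unfold walkLaw; infer_instance

lemma lintegral_walkLaw_zero (ω : Environment) (x : ℤ) (f : ℤ → ENNReal) :
    ∫⁻ X, f (X 0) ∂(walkLaw ω x) = f x := by
  have hf : Measurable f := .of_discrete
  have h : (walkLaw ω x).map (Preorder.frestrictLe (π := fun _ : ℕ => ℤ) 0) =
      (Measure.dirac x).map (MeasurableEquiv.piUnique (fun _ : Finset.Iic 0 => ℤ)).symm := by
    rw [walkLaw, Kernel.trajMeasure, Measure.map_comp _ _ (by fun_prop),
      Kernel.traj_map_frestrictLe, Kernel.partialTraj_self, Measure.id_comp]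
  have h2 : ∫⁻ X, f (X 0) ∂(walkLaw ω x) =
      ∫⁻ y, f (y ⟨0, by simp⟩) ∂((walkLaw ω x).map
        (Preorder.frestrictLe (π := fun _ : ℕ => ℤ) 0)) := by
    rw [lintegral_map (by fun_prop) (by fun_prop)]
    rfl
  rw [h2, h, lintegral_map (by fun_prop) (by fun_prop), lintegral_dirac]
  rfl

/-- The Markov property at the level of one-time marginals. Together with the initial law, this is
all that the moment estimates need to know about `walkLaw`. -/
lemma lintegral_walkLaw_succ (ω : Environment) (x : ℤ) (n : ℕ) (f : ℤ → ENNReal) :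
    ∫⁻ X, f (X (n + 1)) ∂(walkLaw ω x) =
      ∫⁻ X, (ENNReal.ofReal (ω (X n)) * f (X n + 1) +
        ENNReal.ofReal (1 - ω (X n)) * f (X n - 1)) ∂(walkLaw ω x) := by
  have hf : Measurable f := .of_discrete
  have key := Kernel.map_frestrictLe_trajMeasure_compProd_eq_map_trajMeasure
    (X := fun _ : ℕ => ℤ) (μ₀ := Measure.dirac x) (κ := walkKernel ω) (a := n)
  have h2 : ∫⁻ X, f (X (n + 1)) ∂(walkLaw ω x) =
      ∫⁻ y, f y.2 ∂((walkLaw ω x).map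
        (fun X => (Preorder.frestrictLe (π := fun _ : ℕ => ℤ) n X, X (n + 1)))) := by
    rw [lintegral_map (by fun_prop) (by fun_prop)]
  have hg : Measurable fun z : ℤ => ENNReal.ofReal (ω z) * f (z + 1) +
      ENNReal.ofReal (1 - ω z) * f (z - 1) := .of_discrete
  have h3 : ∀ a : Finset.Iic n → ℤ, ∫⁻ b, f b ∂(walkKernel ω n a) =
      ENNReal.ofReal (ω (a ⟨n, by simp⟩)) * f (a ⟨n, by simp⟩ + 1) +
        ENNReal.ofReal (1 - ω (a ⟨n, by simp⟩)) * f (a ⟨n, by simp⟩ - 1) :=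
    fun a => lintegral_stepMeasure ω _ f
  rw [h2, walkLaw, ← key, Measure.lintegral_compProd (by fun_prop)]
  simp only [h3]
  exact lintegral_map (hg.comp (measurable_pi_apply (⟨n, by simp⟩ : Finset.Iic n)))
    (Preorder.measurable_frestrictLe n)

/-- One-step second moment bound for a centred two-valued increment. -/
lemma two_point_sq_le {w a b C M : ℝ} (h0 : 0 ≤ w) (h1 : w ≤ 1) (hm : w * a + (1 - w) * b = 0)
    (ha : |a| ≤ C) (hb : |b| ≤ C) :
    w * (M + a) ^ 2 + (1 - w) * (M + b) ^ 2 ≤ M ^ 2 + C ^ 2 := by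
  have ha2 : a ^ 2 ≤ C ^ 2 := sq_le_sq' (abs_le.1 ha).1 (abs_le.1 ha).2
  have hb2 : b ^ 2 ≤ C ^ 2 := sq_le_sq' (abs_le.1 hb).1 (abs_le.1 hb).2
  have e1 := mul_le_mul_of_nonneg_left ha2 h0
  have e2 := mul_le_mul_of_nonneg_left hb2 (sub_nonneg.2 h1)
  have : w * (M + a) ^ 2 + (1 - w) * (M + b) ^ 2 =
    M ^ 2 + 2 * M * (w * a + (1 - w) * b) + (w * a ^ 2 + (1 - w) * b ^ 2) := by ring
  rw [this, hm]; linarith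

/-- One-step fourth moment bound for a centred two-valued increment. -/
lemma two_point_pow_four_le {w a b C M : ℝ} (h0 : 0 ≤ w) (h1 : w ≤ 1)
    (hm : w * a + (1 - w) * b = 0) (ha : |a| ≤ C) (hb : |b| ≤ C) :
    w * (M + a) ^ 4 + (1 - w) * (M + b) ^ 4 ≤ M ^ 4 + 8 * C ^ 2 * M ^ 2 + 3 * C ^ 4 := by
  have key : ∀ t : ℝ, |t| ≤ C → (M + t) ^ 4 ≤ M ^ 4 + 4 * M ^ 3 * t + 8 * C ^ 2 * M ^ 2 +
      3 * C ^ 4 := by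
    intro t ht
    have t2 : t ^ 2 ≤ C ^ 2 := sq_le_sq' (abs_le.1 ht).1 (abs_le.1 ht).2
    have t4 : t ^ 4 ≤ C ^ 4 := by nlinarith [sq_nonneg t, sq_nonneg C]
    have e : M ^ 2 * t ^ 2 ≤ M ^ 2 * C ^ 2 := mul_le_mul_of_nonneg_left t2 (sq_nonneg M)
    -- The cubic term is absorbed by its even neighbours; the term linear in `t` is kept, since it
    -- averages to zero.
    have e3 : 4 * M * t ^ 3 ≤ 2 * M ^ 2 * t ^ 2 + 2 * t ^ 4 := by
      nlinarith [sq_nonneg (M * t - t ^ 2)]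
    have : (M + t) ^ 4 = M ^ 4 + 4 * M ^ 3 * t + 6 * (M ^ 2 * t ^ 2) + 4 * M * t ^ 3 + t ^ 4 := by
      ring
    linarith
  have e1 := mul_le_mul_of_nonneg_left (key a ha) h0
  have e2 := mul_le_mul_of_nonneg_left (key b hb) (sub_nonneg.2 h1)
  have : 4 * M ^ 3 * (w * a + (1 - w) * b) = 0 := by rw [hm, mul_zero]
  nlinarith

/-! ### From a corrector `h` to the speed: a strong law by fourth moments. -/

section Corrector

variable {ω : Environment} {h : ℤ → ℝ} {C : ℝ}

/-- The increments of the martingale `h (X n) - n` are centred; the unit of elapsed time raises the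
bound from `C` to `C + 1`. -/
lemma corrector_increments (hC : ∀ z, |h (z + 1) - h z| ≤ C)
    (hh : ∀ z, (ω z : ℝ) * h (z + 1) + (1 - ω z) * h (z - 1) = h z + 1) (z : ℤ) :
    (ω z : ℝ) * (h (z + 1) - h z - 1) + (1 - ω z) * (h (z - 1) - h z - 1) = 0 ∧
      |h (z + 1) - h z - 1| ≤ C + 1 ∧ |h (z - 1) - h z - 1| ≤ C + 1 := by
  refine ⟨by linarith [hh z], ?_, ?_⟩
  · have := abs_le.1 (hC z)
    exact abs_le.2 ⟨by linarith, by linarith⟩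
  · have := abs_le.1 (hC (z - 1))
    rw [sub_add_cancel] at this
    exact abs_le.2 ⟨by linarith, by linarith⟩

lemma lintegral_walkLaw_succ_le (x : ℤ) (n : ℕ) (f g : ℤ → ℝ) (hf : ∀ z, 0 ≤ f z)
    (hfg : ∀ z, (ω z : ℝ) * f (z + 1) + (1 - ω z) * f (z - 1) ≤ g z) :
    ∫⁻ X, ENNReal.ofReal (f (X (n + 1))) ∂(walkLaw ω x) ≤
      ∫⁻ X, ENNReal.ofReal (g (X n)) ∂(walkLaw ω x) := by
  rw [lintegral_walkLaw_succ ω x n (fun z => ENNReal.ofReal (f z))]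
  refine lintegral_mono fun X => ?_
  have h0 : (0 : ℝ) ≤ ω (X n) := (ω (X n)).2.1
  have h1 : (0 : ℝ) ≤ 1 - ω (X n) := sub_nonneg.2 (ω (X n)).2.2
  rw [← ENNReal.ofReal_mul h0, ← ENNReal.ofReal_mul h1,
    ← ENNReal.ofReal_add (mul_nonneg h0 (hf _)) (mul_nonneg h1 (hf _))]
  exact ENNReal.ofReal_le_ofReal (hfg _)

lemma lintegral_corrector_sq_le (hC : ∀ z, |h (z + 1) - h z| ≤ C)
    (hh : ∀ z, (ω z : ℝ) * h (z + 1) + (1 - ω z) * h (z - 1) = h z + 1) (x : ℤ) (n : ℕ) :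
    ∫⁻ X, ENNReal.ofReal ((h (X n) - n - h x) ^ 2) ∂(walkLaw ω x) ≤
      ENNReal.ofReal ((C + 1) ^ 2 * n) := by
  induction n with
  | zero =>
    rw [lintegral_walkLaw_zero ω x (fun z => ENNReal.ofReal ((h z - (0 : ℕ) - h x) ^ 2))]
    simp
  | succ n ih =>
    refine (lintegral_walkLaw_succ_le x n (fun z => (h z - (n + 1 : ℕ) - h x) ^ 2)
      (fun z => (h z - n - h x) ^ 2 + (C + 1) ^ 2) (fun z => sq_nonneg _) fun z => ?_).trans ?_
    · obtain ⟨hm, ha, hb⟩ := corrector_increments hC hh z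
      refine le_trans (le_of_eq ?_)
        (two_point_sq_le (M := h z - n - h x) (ω z).2.1 (ω z).2.2 hm ha hb)
      push_cast; ring
    · have hm : Measurable fun X : ℕ → ℤ => ENNReal.ofReal ((h (X n) - n - h x) ^ 2) :=
        (Measurable.of_discrete (f := fun z : ℤ => ENNReal.ofReal ((h z - n - h x) ^ 2))).comp
          (measurable_pi_apply n)
      simp_rw [ENNReal.ofReal_add (sq_nonneg _) (sq_nonneg (C + 1))]
      rw [lintegral_add_left hm, lintegral_const, measure_univ, mul_one]
      refine (add_le_add_left ih _).trans_eq ?_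
      rw [← ENNReal.ofReal_add (by positivity) (by positivity)]
      congr 1; push_cast; ring

lemma lintegral_corrector_pow_four_le (hC : ∀ z, |h (z + 1) - h z| ≤ C)
    (hh : ∀ z, (ω z : ℝ) * h (z + 1) + (1 - ω z) * h (z - 1) = h z + 1) (x : ℤ) (n : ℕ) :
    ∫⁻ X, ENNReal.ofReal ((h (X n) - n - h x) ^ 4) ∂(walkLaw ω x) ≤
      ENNReal.ofReal (4 * (C + 1) ^ 4 * n ^ 2) := by
  induction n with
  | zero =>
    rw [lintegral_walkLaw_zero ω x (fun z => ENNReal.ofReal ((h z - (0 : ℕ) - h x) ^ 4))]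
    simp
  | succ n ih =>
    refine (lintegral_walkLaw_succ_le x n (fun z => (h z - (n + 1 : ℕ) - h x) ^ 4)
      (fun z => (h z - n - h x) ^ 4 + 8 * (C + 1) ^ 2 * (h z - n - h x) ^ 2 + 3 * (C + 1) ^ 4)
      (fun z => by positivity) fun z => ?_).trans ?_
    · obtain ⟨hm, ha, hb⟩ := corrector_increments hC hh z
      refine le_trans (le_of_eq ?_)
        (two_point_pow_four_le (M := h z - n - h x) (ω z).2.1 (ω z).2.2 hm ha hb)
      push_cast; ring
    · have hm : ∀ k : ℕ, Measurable fun X : ℕ → ℤ => ENNReal.ofReal ((h (X n) - n - h x) ^ k) :=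
        fun k => (Measurable.of_discrete
          (f := fun z : ℤ => ENNReal.ofReal ((h z - n - h x) ^ k))).comp (measurable_pi_apply n)
      have hsplit : ∀ X : ℕ → ℤ, ENNReal.ofReal ((h (X n) - n - h x) ^ 4 +
          8 * (C + 1) ^ 2 * (h (X n) - n - h x) ^ 2 + 3 * (C + 1) ^ 4) =
          ENNReal.ofReal ((h (X n) - n - h x) ^ 4) + ENNReal.ofReal (8 * (C + 1) ^ 2) *
            ENNReal.ofReal ((h (X n) - n - h x) ^ 2) + ENNReal.ofReal (3 * (C + 1) ^ 4) := by
        intro X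
        rw [ENNReal.ofReal_add (by positivity) (by positivity),
          ENNReal.ofReal_add (by positivity) (by positivity), ENNReal.ofReal_mul (by positivity)]
      simp_rw [hsplit]
      rw [lintegral_add_right _ measurable_const, lintegral_add_left (hm 4),
        lintegral_const_mul _ (hm 2), lintegral_const, measure_univ, mul_one]
      refine (add_le_add_left (add_le_add ih
        (mul_le_mul_right (lintegral_corrector_sq_le hC hh x n) _)) _).trans ?_
      rw [← ENNReal.ofReal_mul (by positivity), ← ENNReal.ofReal_add (by positivity)
        (by positivity), ← ENNReal.ofReal_add (by positivity) (by positivity)]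
      refine ENNReal.ofReal_le_ofReal ?_
      -- The factor 4 closes the induction: `4 n ^ 2 + 8 n + 3 ≤ 4 (n + 1) ^ 2`.
      push_cast
      nlinarith [show 0 ≤ (C + 1) ^ 4 by positivity]

/-- The strong law of large numbers for the martingale `h (X n) - n`. -/
lemma ae_tendsto_corrector_div (hC : ∀ z, |h (z + 1) - h z| ≤ C)
    (hh : ∀ z, (ω z : ℝ) * h (z + 1) + (1 - ω z) * h (z - 1) = h z + 1) (x : ℤ) :
    ∀ᵐ X ∂(walkLaw ω x), Tendsto (fun n : ℕ => h (X n) / n) atTop (𝓝 1) := by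
  set F : ℕ → (ℕ → ℤ) → ENNReal := fun n X =>
    ENNReal.ofReal (((h (X n) - n - h x) / n) ^ 4) with hF
  have hmeas : ∀ n, Measurable (F n) := fun n => (Measurable.of_discrete
    (f := fun z : ℤ => ENNReal.ofReal (((h z - n - h x) / n) ^ 4))).comp (measurable_pi_apply n)
  have hbound : ∀ n, ∫⁻ X, F n X ∂(walkLaw ω x) ≤
      ENNReal.ofReal (4 * (C + 1) ^ 4 * (1 / (n : ℝ) ^ 2)) := by
    intro n
    have : ∀ X, F n X = ENNReal.ofReal (1 / (n : ℝ) ^ 4) *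
        ENNReal.ofReal ((h (X n) - n - h x) ^ 4) := by
      intro X
      rw [← ENNReal.ofReal_mul (by positivity)]
      refine congrArg ENNReal.ofReal ?_
      rw [div_pow]; ring
    simp_rw [this]
    rw [lintegral_const_mul' _ _ ENNReal.ofReal_ne_top]
    refine (mul_le_mul_right (lintegral_corrector_pow_four_le hC hh x n) _).trans ?_
    rw [← ENNReal.ofReal_mul (by positivity)]
    refine ENNReal.ofReal_le_ofReal (le_of_eq ?_)
    rcases eq_or_ne (n : ℝ) 0 with h0 | h0
    · simp [h0]
    · field_simp
  -- The expectations are `O(1 / n ^ 2)`, so the random series is almost surely finite and its terms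
  -- tend to zero. This replaces Borel–Cantelli.
  have hsum : ∫⁻ X, ∑' n, F n X ∂(walkLaw ω x) ≠ ⊤ := by
    rw [lintegral_tsum fun n => (hmeas n).aemeasurable]
    refine ne_top_of_le_ne_top ?_ (ENNReal.tsum_le_tsum hbound)
    exact ((Real.summable_one_div_nat_pow.2 one_lt_two).mul_left _).tsum_ofReal_ne_top
  have hfin := ae_lt_top' (AEMeasurable.tsum fun n => (hmeas n).aemeasurable) hsum
  filter_upwards [hfin] with X hX
  have h1 : Tendsto (fun n => F n X) atTop (𝓝 0) :=
    ENNReal.tendsto_atTop_zero_of_tsum_ne_top hX.ne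
  have h2 : Tendsto (fun n : ℕ => ((h (X n) - n - h x) / n) ^ 4) atTop (𝓝 0) := by
    have := (ENNReal.tendsto_toReal ENNReal.zero_ne_top).comp h1
    refine this.congr fun n => ?_
    simp only [hF, Function.comp]
    exact ENNReal.toReal_ofReal (by positivity)
  have h3 : Tendsto (fun n : ℕ => (h (X n) - n - h x) / n) atTop (𝓝 0) := by
    have := h2.abs
    simp only [abs_pow, abs_zero] at this
    have h4 := this.rpow_const (p := 1 / 4) (Or.inr (by norm_num))
    rw [Real.zero_rpow (by norm_num)] at h4
    refine (tendsto_zero_iff_abs_tendsto_zero _).2 (h4.congr fun n => ?_)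
    rw [← Real.rpow_natCast, ← Real.rpow_mul (abs_nonneg _)]
    norm_num
  have h5 : Tendsto (fun n : ℕ => h x / (n : ℝ)) atTop (𝓝 0) :=
    tendsto_const_div_atTop_nhds_zero_nat _
  have h6 := (h3.add h5).add_const 1
  simp only [zero_add] at h6
  refine h6.congr' ?_
  filter_upwards [eventually_gt_atTop 0] with n hn
  have : (n : ℝ) ≠ 0 := by positivity
  field_simp; ring

/-- An environment with a monotone Lipschitz solution `h` of `E [h (X 1)] = h + 1` that grows
linearly at `+∞` has a speed, the inverse of the growth rate of `h`. -/
theorem hasSpeed_of_corrector (hmono : Monotone h) (hC : ∀ z, |h (z + 1) - h z| ≤ C)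
    (hh : ∀ z, (ω z : ℝ) * h (z + 1) + (1 - ω z) * h (z - 1) = h z + 1) {κ : ℝ} (hκ : 0 < κ)
    (hlim : Tendsto (fun z : ℤ => h z / z) atTop (𝓝 κ)) : HasSpeed ω κ⁻¹ := by
  intro x
  filter_upwards [ae_tendsto_corrector_div hC hh x] with X hX
  have hinf : Tendsto (fun n : ℕ => h (X n)) atTop atTop := by
    have := hX.pos_mul_atTop one_pos tendsto_natCast_atTop_atTop
    refine this.congr' ?_
    filter_upwards [eventually_gt_atTop 0] with n hn
    have : (n : ℝ) ≠ 0 := by positivity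
    field_simp
  -- Monotonicity turns divergence of `h (X n)` into transience to the right, so only the growth of
  -- `h` at `+∞` matters.
  have hXinf : Tendsto X atTop atTop := by
    refine tendsto_atTop.2 fun b => ?_
    filter_upwards [hinf.eventually_gt_atTop (h b)] with n hn
    exact (hmono.reflect_lt hn).le
  have hratio := hlim.comp hXinf
  have := hX.div hratio hκ.ne'
  rw [one_div] at this
  refine this.congr' ?_
  filter_upwards [hinf.eventually_gt_atTop 0] with n hn
  have : h (X n) ≠ 0 := hn.ne'
  simp only [Pi.div_apply, Function.comp]
  field_simp

end Corrector

/-! ### Counting the points of a strictly increasing integer sequence. -/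

noncomputable section

/-- Every function on the integers has a discrete antiderivative. -/
lemma exists_discrete_antiderivative (g : ℤ → ℝ) : ∃ h : ℤ → ℝ, ∀ z, h (z + 1) = h z + g z := by
  refine ⟨fun z => ∑ j ∈ Finset.range z.toNat, g j -
    ∑ j ∈ Finset.range (-z).toNat, g (-(j : ℤ) - 1), fun z => ?_⟩
  rcases le_or_gt 0 z with hz | hz
  · obtain ⟨n, rfl⟩ := Int.eq_ofNat_of_zero_le hz
    have e1 : ((n : ℤ) + 1).toNat = n + 1 := by omega
    have e2 : (-((n : ℤ) + 1)).toNat = 0 := by omega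
    have e3 : (-(n : ℤ)).toNat = 0 := by omega
    simp only [e1, e2, e3, Finset.sum_range_succ, Int.toNat_natCast, Finset.sum_range_zero, sub_zero]
  · obtain ⟨n, hn⟩ := Int.eq_ofNat_of_zero_le (show 0 ≤ -z - 1 by omega)
    have hz' : z = -(n : ℤ) - 1 := by omega
    have e1 : (z + 1).toNat = 0 := by omega
    have e2 : z.toNat = 0 := by omega
    have e3 : (-(z + 1)).toNat = n := by omega
    have e4 : (-z).toNat = n + 1 := by omega
    simp only [e1, e2, e3, e4, Finset.sum_range_succ, ← hz']
    ring

section Index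

variable {x : ℤ → ℤ}

lemma StrictMono.add_sub_le_int (hx : StrictMono x) {i j : ℤ} (hij : i ≤ j) :
    x i + (j - i) ≤ x j := by
  have : Monotone fun i => x i - i := monotone_int_of_le_succ fun i => by
    have := hx (lt_add_one i)
    omega
  have := this hij
  dsimp only at this
  omega

lemma StrictMono.exists_le_lt_succ (hx : StrictMono x) (z : ℤ) :
    ∃ i, x i ≤ z ∧ z < x (i + 1) := by
  obtain ⟨i, hi, hmax⟩ := Int.exists_greatest_of_bdd (P := fun i => x i ≤ z)
    ⟨max 0 (z - x 0), fun i hi => by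
      by_contra! hlt
      have := hx.add_sub_le_int (i := 0) (j := i) (by omega)
      omega⟩
    ⟨min 0 (z - x 0), by
      have := hx.add_sub_le_int (i := min 0 (z - x 0)) (j := 0) (by omega)
      omega⟩
  refine ⟨i, hi, ?_⟩
  by_contra! hlt
  have := hmax (i + 1) hlt
  omega

/-- The index of the last point of the sequence `x` that is at most `z`. -/
def lastIndex (hx : StrictMono x) (z : ℤ) : ℤ := (hx.exists_le_lt_succ z).choose

lemma le_lastIndex (hx : StrictMono x) (z : ℤ) : x (lastIndex hx z) ≤ z :=
  (hx.exists_le_lt_succ z).choose_spec.1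

lemma lt_lastIndex_succ (hx : StrictMono x) (z : ℤ) : z < x (lastIndex hx z + 1) :=
  (hx.exists_le_lt_succ z).choose_spec.2

lemma lastIndex_eq (hx : StrictMono x) {z i : ℤ} (h1 : x i ≤ z) (h2 : z < x (i + 1)) :
    lastIndex hx z = i := by
  have h3 := hx.lt_iff_lt.1 ((le_lastIndex hx z).trans_lt h2)
  have h4 := hx.lt_iff_lt.1 (h1.trans_lt (lt_lastIndex_succ hx z))
  omega

lemma lastIndex_apply (hx : StrictMono x) (i : ℤ) : lastIndex hx (x i) = i :=
  lastIndex_eq hx le_rfl (hx (lt_add_one i))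

lemma lastIndex_apply_sub_one (hx : StrictMono x) (i : ℤ) : lastIndex hx (x i - 1) = i - 1 :=
  lastIndex_eq hx (by have := hx (sub_one_lt i); omega) (by rw [sub_add_cancel]; omega)

lemma lastIndex_sub_one (hx : StrictMono x) {z : ℤ} (hz : z ∉ Set.range x) :
    lastIndex hx (z - 1) = lastIndex hx z := by
  refine lastIndex_eq hx ?_ (by have := lt_lastIndex_succ hx z; omega)
  have h1 := le_lastIndex hx z
  have h2 : x (lastIndex hx z) ≠ z := fun h => hz ⟨_, h⟩
  omega

lemma lastIndex_add_sum_indicator (hx : StrictMono x) (n : ℕ) :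
    ((lastIndex hx (-1) : ℤ) : ℝ) + ∑ y ∈ Finset.range n,
      Set.indicator (Set.range x) (fun _ => (1 : ℝ)) (y : ℤ) = lastIndex hx ((n : ℤ) - 1) := by
  induction n with
  | zero => simp
  | succ n ih =>
    rw [Finset.sum_range_succ, ← add_assoc, ih]
    push_cast
    rw [add_sub_cancel_right]
    by_cases hn : (n : ℤ) ∈ Set.range x
    · obtain ⟨i, hi⟩ := hn
      rw [Set.indicator_of_mem (Set.mem_range.2 ⟨i, hi⟩), ← hi, lastIndex_apply, lastIndex_apply_sub_one]
      push_cast; ring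
    · rw [Set.indicator_of_notMem hn, lastIndex_sub_one hx hn, add_zero]

lemma monotone_lastIndex (hx : StrictMono x) : Monotone (lastIndex hx) := by
  intro y z hyz
  have := hx.lt_iff_lt.1 (((le_lastIndex hx y).trans hyz).trans_lt (lt_lastIndex_succ hx z))
  omega

lemma tendsto_lastIndex (hx : StrictMono x) : Tendsto (lastIndex hx) atTop atTop := by
  refine tendsto_atTop.2 fun b => ?_
  filter_upwards [eventually_ge_atTop (x b)] with z hz
  have := monotone_lastIndex hx hz
  rwa [lastIndex_apply] at this

/-- Passes from growth along the points of `x` to growth along all integers, when `h` varies by at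
most `B` since the last point. It is applied to the identity and to the corrector, and the quotient
of the two limits is the growth rate per unit length. -/
lemma tendsto_div_lastIndex (hx : StrictMono x) {h : ℤ → ℝ} {B κ : ℝ}
    (hB : ∀ z, |h z - h (x (lastIndex hx z))| ≤ B)
    (hlim : Tendsto (fun n : ℕ => h (x n) / n) atTop (𝓝 κ)) :
    Tendsto (fun z : ℤ => h z / lastIndex hx z) atTop (𝓝 κ) := by
  have hI := tendsto_lastIndex hx
  have hN : Tendsto (fun z => (lastIndex hx z).toNat) atTop atTop :=
    tendsto_atTop.2 fun b => by
      filter_upwards [hI.eventually_ge_atTop (b : ℤ)] with z hz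
      omega
  have h1 : Tendsto (fun z : ℤ => h (x (lastIndex hx z)) / lastIndex hx z) atTop (𝓝 κ) := by
    refine (hlim.comp hN).congr' ?_
    filter_upwards [hI.eventually_ge_atTop 0] with z hz
    have e : (((lastIndex hx z).toNat : ℕ) : ℤ) = lastIndex hx z := Int.toNat_of_nonneg hz
    have e' : (((lastIndex hx z).toNat : ℕ) : ℝ) = lastIndex hx z := by exact_mod_cast e
    simp only [Function.comp, e, e']
  have h2 : Tendsto (fun z : ℤ => (h z - h (x (lastIndex hx z))) / lastIndex hx z) atTop (𝓝 0) := by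
    have h3 : Tendsto (fun z : ℤ => B / (lastIndex hx z : ℝ)) atTop (𝓝 0) :=
      (tendsto_intCast_atTop_atTop.comp hI).const_div_atTop B
    refine squeeze_zero_norm' ?_ h3
    filter_upwards [hI.eventually_gt_atTop 0] with z hz
    have : (0 : ℝ) < lastIndex hx z := by exact_mod_cast hz
    rw [Real.norm_eq_abs, abs_div, abs_of_pos this]
    gcongr
    exact hB z
  have h3 := h1.add h2
  rw [add_zero] at h3
  refine h3.congr fun z => ?_
  rw [← add_div]; congr 1; ring

/-- The upper density of the range of `x` is the inverse of the mean gap. -/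
lemma limsup_density_range (hx : StrictMono x) {M L : ℝ}
    (hM : ∀ i, ((x (i + 1) : ℝ) - x i) ≤ M) (hLpos : 0 < L)
    (hL : Tendsto (fun n : ℕ => (x n : ℝ) / n) atTop (𝓝 L)) :
    limsup (fun n : ℕ => (1 / ((n : ℝ) + 1)) * ∑ y ∈ Finset.range (n + 1),
      Set.indicator (Set.range x) (fun _ => (1 : ℝ)) (y : ℤ)) atTop = L⁻¹ := by
  refine Tendsto.limsup_eq ?_
  have h1 : Tendsto (fun z : ℤ => (z : ℝ) / lastIndex hx z) atTop (𝓝 L) := by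
    refine tendsto_div_lastIndex hx (h := fun z => (z : ℝ)) (B := M) (fun z => ?_) hL
    have e1 : ((x (lastIndex hx z) : ℤ) : ℝ) ≤ z := by exact_mod_cast le_lastIndex hx z
    have e2 : (z : ℝ) ≤ ((x (lastIndex hx z + 1) : ℤ) : ℝ) := by
      exact_mod_cast (lt_lastIndex_succ hx z).le
    rw [abs_of_nonneg (by linarith)]
    linarith [hM (lastIndex hx z)]
  have h2 := (h1.inv₀ hLpos.ne').comp tendsto_natCast_atTop_atTop
  have h3 : Tendsto (fun n : ℕ => (n : ℝ) / (n + 1)) atTop (𝓝 1) := tendsto_natCast_div_add_atTop 1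
  have h4 : Tendsto (fun n : ℕ => (lastIndex hx (-1) : ℝ) / ((n : ℝ) + 1)) atTop (𝓝 0) :=
    ((tendsto_natCast_atTop_atTop (R := ℝ)).atTop_add tendsto_const_nhds).const_div_atTop _
  have h5 := (h2.mul h3).sub h4
  rw [mul_one, sub_zero] at h5
  refine h5.congr' ?_
  filter_upwards [eventually_gt_atTop 0] with n hn
  have hn' : (n : ℝ) ≠ 0 := by positivity
  -- The number of points in `[0, n]` is the last index at `n` minus the one at `-1`; the latter is
  -- constant and vanishes in the average.
  have e := lastIndex_add_sum_indicator hx (n + 1)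
  push_cast at e
  rw [add_sub_cancel_right] at e
  rw [eq_sub_of_add_eq' e]
  simp only [Function.comp, Int.cast_natCast, inv_div]
  field_simp

end Index
end

/-! ### The explicit corrector and the speed formula. -/

noncomputable section

section Slope

variable {u : ℤ → ℝ} {M r : ℝ}

/-- Exponentially weighted sum of the past of `u`: the expected time needed by the walk for a step
to the right from the drift point number `i`, when the gaps between drift points are `u`. -/
def driftSlope (r : ℝ) (u : ℤ → ℝ) (i : ℤ) : ℝ := 1 + 2 * ∑' k : ℕ, r ^ (k + 1) * u (i - 1 - k)

lemma summable_geometric_succ (hr0 : 0 ≤ r) (hr1 : r < 1) : Summable fun k : ℕ => r ^ (k + 1) := by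
  simpa [pow_succ] using (summable_geometric_of_lt_one hr0 hr1).mul_right r

lemma tsum_geometric_succ (hr0 : 0 ≤ r) (hr1 : r < 1) :
    ∑' k : ℕ, r ^ (k + 1) = r / (1 - r) := by
  simp_rw [pow_succ, tsum_mul_right, tsum_geometric_of_lt_one hr0 hr1]
  field_simp

lemma summable_driftSlope (hr0 : 0 ≤ r) (hr1 : r < 1) (hu : ∀ i, 0 ≤ u i ∧ u i ≤ M) (i : ℤ) :
    Summable fun k : ℕ => r ^ (k + 1) * u (i - 1 - k) :=
  ((summable_geometric_succ hr0 hr1).mul_right M).of_nonneg_of_le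
    (fun k => mul_nonneg (by positivity) (hu _).1)
    (fun k => mul_le_mul_of_nonneg_left (hu _).2 (by positivity))

lemma one_le_driftSlope (hr0 : 0 ≤ r) (hu : ∀ i, 0 ≤ u i ∧ u i ≤ M) (i : ℤ) : 1 ≤ driftSlope r u i := by
  have : 0 ≤ ∑' k : ℕ, r ^ (k + 1) * u (i - 1 - k) :=
    tsum_nonneg fun k => mul_nonneg (by positivity) (hu _).1
  unfold driftSlope
  linarith

lemma driftSlope_le (hr0 : 0 ≤ r) (hr1 : r < 1) (hu : ∀ i, 0 ≤ u i ∧ u i ≤ M) (i : ℤ) :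
    driftSlope r u i ≤ 1 + 2 * ∑' k : ℕ, r ^ (k + 1) * M := by
  have := (summable_driftSlope hr0 hr1 hu i).tsum_le_tsum
    (fun k : ℕ => mul_le_mul_of_nonneg_left (hu (i - 1 - k)).2 (by positivity : 0 ≤ r ^ (k + 1)))
    ((summable_geometric_succ hr0 hr1).mul_right M)
  unfold driftSlope
  linarith

/-- Splitting off the most recent gap, the term `k = 0`, leaves `r` times the series at `i - 1`.
This is the recursion that the corrector equation imposes at a drift point. -/
lemma driftSlope_eq (hr0 : 0 ≤ r) (hr1 : r < 1) (hu : ∀ i, 0 ≤ u i ∧ u i ≤ M) (i : ℤ) :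
    driftSlope r u i = 1 - r + r * (driftSlope r u (i - 1) + 2 * u (i - 1)) := by
  have h := (summable_driftSlope hr0 hr1 hu i).tsum_eq_zero_add
  have h2 : ∀ k : ℕ, r ^ (k + 1 + 1) * u (i - 1 - (k + 1 : ℕ)) =
      r * (r ^ (k + 1) * u (i - 1 - 1 - k)) := fun k => by
    rw [show i - 1 - ((k + 1 : ℕ) : ℤ) = i - 1 - 1 - k by push_cast; ring]; ring
  simp only [h2, tsum_mul_left] at h
  unfold driftSlope
  rw [h]
  simp only [zero_add, pow_one, Nat.cast_zero, sub_zero]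
  ring

end Slope

/-- The gap between two consecutive points of the sequence `x`. -/
def gap (x : ℤ → ℤ) (i : ℤ) : ℝ := x (i + 1) - x i

lemma abs_sub_le_of_int_lipschitz {h : ℤ → ℝ} {C : ℝ} (hC : ∀ z, |h (z + 1) - h z| ≤ C) {y z : ℤ}
    (hyz : y ≤ z) : |h z - h y| ≤ C * (z - y) := by
  induction z, hyz using Int.leInduction with
  | base => simp
  | succ z _ ih =>
    have e : h (z + 1) - h y = (h (z + 1) - h z) + (h z - h y) := by ring
    rw [e]
    refine (abs_add_le _ _).trans ?_
    push_cast
    linarith [hC z]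

section Corrector

variable {x : ℤ → ℤ} {M p : ℝ} {ω : Environment}

/-- For the slopes `g z = h (z + 1) - h z` the equation reads `ω z * g z = (1 - ω z) * g (z - 1) +
1`. At a fair site the slope rises by 2; at a drift point it becomes `r * g (z - 1) + 1 + r`. Inside
a gap the slopes form an arithmetic progression, and summing it gives the last clause. -/
lemma exists_corrector (hp : 1 / 2 < p) (hp1 : p ≤ 1) (hx : StrictMono x)
    (hM : ∀ i, 0 ≤ gap x i ∧ gap x i ≤ M)
    (hω : ∀ z, (z ∈ Set.range x → (ω z : ℝ) = p) ∧ (z ∉ Set.range x → (ω z : ℝ) = 1 / 2)) :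
    ∃ (h : ℤ → ℝ) (C : ℝ), Monotone h ∧ (∀ z, |h (z + 1) - h z| ≤ C) ∧
      (∀ z, (ω z : ℝ) * h (z + 1) + (1 - ω z) * h (z - 1) = h z + 1) ∧
      ∀ i, h (x (i + 1)) =
        h (x i) + (gap x i * driftSlope ((1 - p) / p) (gap x) i + gap x i * (gap x i - 1)) := by
  set r := (1 - p) / p with hr
  have hp0 : 0 < p := by linarith
  have hr0 : 0 ≤ r := div_nonneg (by linarith) hp0.le
  have hr1 : r < 1 := by rw [hr, div_lt_one hp0]; linarith
  have hpr : p * r = 1 - p := by rw [hr]; field_simp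
  set I := lastIndex hx with hI
  set g : ℤ → ℝ := fun z => driftSlope r (gap x) (I z) + 2 * (z - x (I z)) with hg
  obtain ⟨h, hh⟩ := exists_discrete_antiderivative g
  have hgap : ∀ z : ℤ, 0 ≤ (z : ℝ) - x (I z) ∧ (z : ℝ) - x (I z) ≤ M := fun z => by
    have e1 : ((x (I z) : ℤ) : ℝ) ≤ z := by exact_mod_cast le_lastIndex hx z
    have e2 : (z : ℝ) ≤ ((x (I z + 1) : ℤ) : ℝ) := by exact_mod_cast (lt_lastIndex_succ hx z).le
    have e3 := (hM (I z)).2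
    unfold gap at e3
    exact ⟨by linarith, by linarith⟩
  have hg0 : ∀ z, 0 ≤ g z := fun z => by
    have := one_le_driftSlope hr0 hM (I z)
    have := (hgap z).1
    simp only [hg]; linarith
  refine ⟨h, 1 + 2 * ∑' k : ℕ, r ^ (k + 1) * M + 2 * M, ?_, ?_, ?_, ?_⟩
  · exact monotone_int_of_le_succ fun z => by rw [hh]; linarith [hg0 z]
  · intro z
    rw [hh, add_sub_cancel_left, abs_of_nonneg (hg0 z)]
    have := driftSlope_le hr0 hr1 hM (I z)
    have := (hgap z).2
    simp only [hg]; linarith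
  · intro z
    have e := hh (z - 1)
    rw [sub_add_cancel] at e
    suffices hs : (ω z : ℝ) * g z = (1 - ω z) * g (z - 1) + 1 by
      rw [hh z]
      have : h (z - 1) = h z - g (z - 1) := by linarith
      rw [this]
      linarith
    by_cases hz : z ∈ Set.range x
    · rw [(hω z).1 hz]
      obtain ⟨i, rfl⟩ := hz
      simp only [hg, hI, lastIndex_apply, lastIndex_apply_sub_one]
      rw [driftSlope_eq hr0 hr1 hM i, gap, sub_add_cancel]
      push_cast
      rw [sub_self, mul_zero, add_zero, mul_add, ← mul_assoc, hpr, mul_sub, hpr]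
      ring
    · rw [(hω z).2 hz]
      simp only [hg, hI, lastIndex_sub_one hx hz]
      push_cast
      ring
  · intro i
    have key : ∀ j : ℕ, x i + j ≤ x (i + 1) →
        h (x i + j) = h (x i) + (j * driftSlope r (gap x) i + j * (j - 1)) := by
      intro j
      induction j with
      | zero => simp
      | succ j ih =>
        intro hj
        have e1 : x i + ((j + 1 : ℕ) : ℤ) = x i + j + 1 := by push_cast; ring
        rw [e1] at hj ⊢
        have e2 : I (x i + j) = i := lastIndex_eq hx (by omega) (by omega)
        rw [hh, ih (by omega)]
        simp only [hg, e2]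
        push_cast
        ring
    obtain ⟨j, hj⟩ := Int.eq_ofNat_of_zero_le (sub_nonneg.2 (hx (lt_add_one i)).le)
    have e3 : x (i + 1) = x i + j := by omega
    have e4 : gap x i = j := by unfold gap; rw [e3]; push_cast; ring
    rw [e4, e3]
    exact key j (by omega)

/-- If the gaps between the drift points have mean `L` and correlations `c k`, then the walk has a
speed, which is the ratio of `L` and an explicit quadratic functional. -/
lemma hasSpeed_of_gap_correlations (hp : 1 / 2 < p) (hp1 : p ≤ 1) (hx : StrictMono x)
    (hM : ∀ i, 0 ≤ gap x i ∧ gap x i ≤ M)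
    (hω : ∀ z, (z ∈ Set.range x → (ω z : ℝ) = p) ∧ (z ∉ Set.range x → (ω z : ℝ) = 1 / 2))
    {L : ℝ} (hLpos : 0 < L) (hL : Tendsto (fun n : ℕ => (x n : ℝ) / n) atTop (𝓝 L)) {c : ℕ → ℝ}
    (hc : ∀ k : ℕ, Tendsto (fun n : ℕ => (∑ i ∈ Finset.range n, gap x i * gap x (i - k)) / n)
      atTop (𝓝 (c k)))
    (hpos : 0 < c 0 + 2 * ∑' k : ℕ, ((1 - p) / p) ^ (k + 1) * c (k + 1)) :
    HasSpeed ω (L / (c 0 + 2 * ∑' k : ℕ, ((1 - p) / p) ^ (k + 1) * c (k + 1))) := by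
  obtain ⟨h, C, hmono, hC, hcor, hstep⟩ := exists_corrector hp hp1 hx hM hω
  set r := (1 - p) / p with hr
  have hp0 : 0 < p := by linarith
  have hr0 : 0 ≤ r := div_nonneg (by linarith) hp0.le
  have hr1 : r < 1 := by rw [hr, div_lt_one hp0]; linarith
  set κ := c 0 + 2 * ∑' k : ℕ, r ^ (k + 1) * c (k + 1) with hκ
  have hM0 : 0 ≤ M := (hM 0).1.trans (hM 0).2
  have hC0 : 0 ≤ C := (abs_nonneg _).trans (hC 0)
  -- The constant 1 in `driftSlope` cancels the `-1`, leaving only products of two gaps.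
  have hF : ∀ i, gap x i * driftSlope r (gap x) i + gap x i * (gap x i - 1) =
      gap x i * gap x (i - (0 : ℕ)) +
        2 * ∑' k : ℕ, r ^ (k + 1) * (gap x i * gap x (i - (k + 1 : ℕ))) := by
    intro i
    have e : ∀ k : ℕ, r ^ (k + 1) * (gap x i * gap x (i - (k + 1 : ℕ))) =
        gap x i * (r ^ (k + 1) * gap x (i - 1 - k)) := fun k => by
      rw [show i - ((k + 1 : ℕ) : ℤ) = i - 1 - k by push_cast; ring]; ring
    simp only [e, tsum_mul_left, driftSlope, Nat.cast_zero, sub_zero]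
    ring
  have hsm : ∀ i : ℤ, Summable fun k : ℕ => r ^ (k + 1) * (gap x i * gap x (i - (k + 1 : ℕ))) :=
    fun i => ((summable_geometric_succ hr0 hr1).mul_right (M * M)).of_nonneg_of_le
      (fun k => mul_nonneg (by positivity) (mul_nonneg (hM _).1 (hM _).1))
      (fun k => mul_le_mul_of_nonneg_left
        (mul_le_mul (hM _).2 (hM _).2 (hM _).1 hM0) (by positivity))
  have hsum : ∀ n : ℕ, h (x n) = h (x 0) + (∑ i ∈ Finset.range n, gap x i * gap x (i - (0 : ℕ)) +
      2 * ∑' k : ℕ, r ^ (k + 1) * ∑ i ∈ Finset.range n, gap x i * gap x (i - (k + 1 : ℕ))) := by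
    intro n
    have : h (x n) = h (x 0) + ∑ i ∈ Finset.range n,
        (gap x i * gap x (i - (0 : ℕ)) +
        2 * ∑' k : ℕ, r ^ (k + 1) * (gap x i * gap x (i - (k + 1 : ℕ)))) := by
      induction n with
      | zero => simp
      | succ n ih =>
        rw [Finset.sum_range_succ, ← add_assoc, ← ih, Nat.cast_succ, hstep, hF]
    have hswap := Summable.tsum_finsetSum (s := Finset.range n)
      (f := fun (i : ℕ) (k : ℕ) => r ^ (k + 1) * (gap x i * gap x (i - (k + 1 : ℕ))))
      fun i _ => hsm i
    rw [this, Finset.sum_add_distrib, ← Finset.mul_sum, ← hswap]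
    simp_rw [Finset.mul_sum]
  have hlim : Tendsto (fun n : ℕ => h (x n) / n) atTop (𝓝 κ) := by
    have hdom : Tendsto (fun n : ℕ => ∑' k : ℕ, r ^ (k + 1) *
        ((∑ i ∈ Finset.range n, gap x i * gap x (i - (k + 1 : ℕ))) / n)) atTop
        (𝓝 (∑' k : ℕ, r ^ (k + 1) * c (k + 1))) := by
      -- Every averaged correlation is at most `M * M`, so the geometric weights dominate.
      refine tendsto_tsum_of_dominated_convergence (bound := fun k => r ^ (k + 1) * (M * M))
        ((summable_geometric_succ hr0 hr1).mul_right _) (fun k => (hc (k + 1)).const_mul _) ?_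
      filter_upwards [eventually_gt_atTop 0] with n hn k
      have hn' : (0 : ℝ) < n := by exact_mod_cast hn
      have h0 : 0 ≤ ∑ i ∈ Finset.range n, gap x i * gap x (i - (k + 1 : ℕ)) :=
        Finset.sum_nonneg fun i _ => mul_nonneg (hM _).1 (hM _).1
      rw [Real.norm_of_nonneg (by positivity)]
      refine mul_le_mul_of_nonneg_left ?_ (by positivity)
      rw [div_le_iff₀ hn']
      refine (Finset.sum_le_card_nsmul _ _ (M * M) fun i _ =>
        mul_le_mul (hM _).2 (hM _).2 (hM _).1 hM0).trans_eq ?_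
      simp [mul_comm]
    have h0 : Tendsto (fun n : ℕ => h (x 0) / (n : ℝ)) atTop (𝓝 0) :=
      tendsto_const_div_atTop_nhds_zero_nat _
    have := h0.add ((hc 0).add (hdom.const_mul 2))
    rw [zero_add] at this
    refine this.congr fun n => ?_
    rw [hsum n]
    simp_rw [← mul_div_assoc, tsum_div_const]
    ring
  have hI := tendsto_lastIndex hx
  have hgap : ∀ z : ℤ, 0 ≤ (z : ℝ) - x (lastIndex hx z) ∧ (z : ℝ) - x (lastIndex hx z) ≤ M :=
    fun z => by
      have e1 : ((x (lastIndex hx z) : ℤ) : ℝ) ≤ z := by exact_mod_cast le_lastIndex hx z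
      have e2 : (z : ℝ) ≤ ((x (lastIndex hx z + 1) : ℤ) : ℝ) := by
        exact_mod_cast (lt_lastIndex_succ hx z).le
      have e3 := (hM (lastIndex hx z)).2
      unfold gap at e3
      exact ⟨by linarith, by linarith⟩
  have h1 := tendsto_div_lastIndex hx (h := h) (B := C * M) (fun z =>
    (abs_sub_le_of_int_lipschitz hC (le_lastIndex hx z)).trans
      (mul_le_mul_of_nonneg_left (hgap z).2 hC0)) hlim
  have h2 := tendsto_div_lastIndex hx (h := fun z => (z : ℝ)) (B := M) (fun z => by
    rw [abs_of_nonneg (hgap z).1]; exact (hgap z).2) hL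
  have h3 : Tendsto (fun z : ℤ => h z / z) atTop (𝓝 (κ / L)) := by
    -- `h` grows by `κ` and the position by `L` per drift point.
    refine (h1.div h2 hLpos.ne').congr' ?_
    filter_upwards [hI.eventually_gt_atTop 0] with z hz
    have : (lastIndex hx z : ℝ) ≠ 0 := by exact_mod_cast hz.ne'
    simp only [Pi.div_apply]
    exact div_div_div_cancel_right₀ this _ _
  have := hasSpeed_of_corrector hmono hC hcor (div_pos hpos hLpos) h3
  rwa [inv_div] at this

end Corrector

/-! ### Cesàro limits and correlations of bounded sequences. -/

section Cesaro

variable {u : ℤ → ℝ} {M : ℝ}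

lemma tendsto_bounded_div_atTop {b : ℕ → ℝ} {B : ℝ} (hb : ∀ n, |b n| ≤ B) :
    Tendsto (fun n : ℕ => b n / n) atTop (𝓝 0) := by
  refine squeeze_zero_norm (a := fun n : ℕ => B / (n : ℝ)) (fun n => ?_)
    (tendsto_const_div_atTop_nhds_zero_nat B)
  rw [Real.norm_eq_abs, abs_div, Nat.abs_cast]
  gcongr
  exact hb n

/-- Cesàro limits of bounded sequences are invariant under shifts. -/
lemma tendsto_cesaro_shift (hu : ∀ i, |u i| ≤ M) {c : ℝ}
    (hc : Tendsto (fun n : ℕ => (∑ i ∈ Finset.range n, u i) / n) atTop (𝓝 c)) (k : ℕ) :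
    Tendsto (fun n : ℕ => (∑ i ∈ Finset.range n, u (i - k)) / n) atTop (𝓝 c) := by
  induction k with
  | zero => simpa using hc
  | succ k ih =>
    have h0 := tendsto_bounded_div_atTop
      (b := fun n : ℕ => u (-(k + 1 : ℕ)) - u (n - (k + 1 : ℕ))) (B := M + M)
      fun n => (abs_sub _ _).trans (add_le_add (hu _) (hu _))
    have := ih.add h0
    rw [add_zero] at this
    refine this.congr fun n => ?_
    rw [← add_div]
    congr 1
    induction n with
    | zero => simp
    | succ n ihn =>
      rw [Finset.sum_range_succ, Finset.sum_range_succ, ← ihn]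
      rw [show ((n + 1 : ℕ) : ℤ) - (k + 1 : ℕ) = n - k by push_cast; ring]
      ring

/-- Periodic sequences have Cesàro limits. -/
lemma exists_tendsto_cesaro_of_periodic {v : ℕ → ℝ} {q : ℕ} (hq : 0 < q)
    (hv : Function.Periodic v q) :
    ∃ c : ℝ, Tendsto (fun n : ℕ => (∑ i ∈ Finset.range n, v i) / n) atTop (𝓝 c) := by
  set m := (∑ i ∈ Finset.range q, v i) / q with hm
  have hq' : (q : ℝ) ≠ 0 := by positivity
  set d : ℕ → ℝ := fun n => ∑ i ∈ Finset.range n, v i - n * m with hd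
  -- Subtracting the mean over one period makes the partial sums periodic, hence bounded.
  have hper : Function.Periodic d q := fun n => by
    have hs : ∑ i ∈ Finset.range (n + q), v i =
        ∑ i ∈ Finset.range n, v i + ∑ i ∈ Finset.range q, v i := by
      induction n with
      | zero => simp
      | succ n ih =>
        rw [Finset.sum_range_succ, add_right_comm, Finset.sum_range_succ, ih, hv n]; ring
    simp only [hd, hs, hm]
    push_cast
    field_simp
    ring
  have hbd : ∀ n, |d n| ≤ ∑ i ∈ Finset.range q, |d i| := fun n => by
    rw [← hper.map_mod_nat n]
    exact Finset.single_le_sum (f := fun i => |d i|) (fun i _ => abs_nonneg _)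
      (Finset.mem_range.2 (Nat.mod_lt n hq))
  refine ⟨m, ?_⟩
  have := (tendsto_bounded_div_atTop hbd).add_const m
  rw [zero_add] at this
  refine this.congr' ?_
  filter_upwards [eventually_gt_atTop 0] with n hn
  have : (n : ℝ) ≠ 0 := by positivity
  simp only [hd]
  field_simp
  ring

/-- A bounded sequence with few jumps has the same correlations at all distances. -/
lemma tendsto_correlation_of_few_jumps (hu : ∀ i, |u i| ≤ M) {c : ℝ}
    (hc : Tendsto (fun n : ℕ => (∑ i ∈ Finset.range n, u i * u i) / n) atTop (𝓝 c))
    (hj : Tendsto (fun n : ℕ => (∑ i ∈ Finset.range n, |u (i + 1) - u i|) / n) atTop (𝓝 0))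
    (k : ℕ) :
    Tendsto (fun n : ℕ => (∑ i ∈ Finset.range n, u i * u (i - k)) / n) atTop (𝓝 c) := by
  have hM : 0 ≤ M := (abs_nonneg _).trans (hu 0)
  induction k with
  | zero => simpa using hc
  | succ k ih =>
    have h1 := tendsto_cesaro_shift (u := fun i => |u (i + 1) - u i|) (M := M + M)
      (fun i => by rw [abs_abs]; exact (abs_sub _ _).trans (add_le_add (hu _) (hu _))) hj (k + 1)
    -- Raising the lag by one changes the sum by at most `M` times the total of the jumps shifted by
    -- `k + 1`.
    have h2 : Tendsto (fun n : ℕ => (∑ i ∈ Finset.range n, u i * u (i - (k + 1 : ℕ))) / n -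
        (∑ i ∈ Finset.range n, u i * u (i - k)) / n) atTop (𝓝 0) := by
      have h3 := h1.const_mul M
      rw [mul_zero] at h3
      refine squeeze_zero_norm (fun n => ?_) h3
      rw [← sub_div, ← Finset.sum_sub_distrib, Real.norm_eq_abs, abs_div, Nat.abs_cast,
        ← mul_div_assoc, Finset.mul_sum]
      gcongr
      refine (Finset.abs_sum_le_sum_abs _ _).trans (Finset.sum_le_sum fun i _ => ?_)
      rw [← mul_sub, abs_mul, abs_sub_comm,
        show (i : ℤ) - (k + 1 : ℕ) + 1 = i - k by push_cast; ring]
      gcongr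
      exact hu _
    have := ih.add h2
    rw [add_zero] at this
    refine this.congr fun n => ?_
    ring

end Cesaro

/-! ### The speed bound for nearly equal gaps. -/

lemma sum_gap (x : ℤ → ℤ) (n : ℕ) : ∑ i ∈ Finset.range n, gap x i = x n - x 0 := by
  induction n with
  | zero => simp
  | succ n ih => rw [Finset.sum_range_succ, ih, gap]; push_cast; ring

lemma tendsto_cesaro_gap {x : ℤ → ℤ} {L : ℝ}
    (hL : Tendsto (fun n : ℕ => (x n : ℝ) / n) atTop (𝓝 L)) :
    Tendsto (fun n : ℕ => (∑ i ∈ Finset.range n, gap x i) / n) atTop (𝓝 L) := by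
  have := hL.sub (tendsto_const_div_atTop_nhds_zero_nat (x 0 : ℝ))
  rw [sub_zero] at this
  refine this.congr fun n => ?_
  rw [sum_gap, sub_div]

/-- Lower bound for the speed when all gaps between drift points are within `1` of their mean. -/
theorem exists_hasSpeed_ge {x : ℤ → ℤ} {p L : ℝ} {ω : Environment} (hp : 1 / 2 < p) (hp1 : p ≤ 1)
    (hx : StrictMono x) (hLpos : 0 < L) (hgap : ∀ i, |gap x i - L| ≤ 1)
    (hω : ∀ z, (z ∈ Set.range x → (ω z : ℝ) = p) ∧ (z ∉ Set.range x → (ω z : ℝ) = 1 / 2))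
    (hL : Tendsto (fun n : ℕ => (x n : ℝ) / n) atTop (𝓝 L))
    (hc : ∀ k : ℕ, ∃ c, Tendsto
      (fun n : ℕ => (∑ i ∈ Finset.range n, gap x i * gap x (i - k)) / n) atTop (𝓝 c)) :
    ∃ v, HasSpeed ω v ∧ (2 * p - 1) * (L / (L ^ 2 + 1)) ≤ v := by
  choose c hc using hc
  have h1 : ∀ i, 1 ≤ gap x i := fun i => by
    have : x i + 1 ≤ x (i + 1) := hx (lt_add_one i)
    have : (x i : ℝ) + 1 ≤ x (i + 1) := by exact_mod_cast this
    unfold gap; linarith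
  have hM : ∀ i, 0 ≤ gap x i ∧ gap x i ≤ L + 1 := fun i =>
    ⟨by linarith [h1 i], by linarith [(abs_le.1 (hgap i)).2]⟩
  have hp0 : 0 < p := by linarith
  set r := (1 - p) / p with hr
  have hr0 : 0 ≤ r := div_nonneg (by linarith) hp0.le
  have hr1 : r < 1 := by rw [hr, div_lt_one hp0]; linarith
  have hmean := tendsto_cesaro_gap hL
  have hcle : ∀ k, c k ≤ L ^ 2 + 1 := fun k => by
    have hshift := tendsto_cesaro_shift (u := gap x) (M := L + 1)
      (fun i => by rw [abs_of_nonneg (hM i).1]; exact (hM i).2) hmean k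
    have hup := (((hmean.const_mul L).add (hshift.const_mul L)).add_const (1 - L ^ 2))
    refine (le_of_tendsto_of_tendsto (hc k) hup ?_).trans_eq (by ring)
    filter_upwards [eventually_gt_atTop 0] with n hn
    have hn' : (0 : ℝ) < n := by exact_mod_cast hn
    -- This is `(u i - L) * (u (i - k) - L) ≤ 1` expanded; after averaging the right side tends to
    -- `L ^ 2 + L ^ 2 + 1 - L ^ 2`.
    have hs : ∑ i ∈ Finset.range n, gap x i * gap x (i - k) ≤
        ∑ i ∈ Finset.range n, (L * gap x i + L * gap x (i - k) + (1 - L ^ 2)) := by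
      refine Finset.sum_le_sum fun i _ => ?_
      have := mul_le_mul (hgap i) (hgap (i - k)) (abs_nonneg _) zero_le_one
      rw [← abs_mul] at this
      have := (abs_le.1 this).2
      nlinarith
    rw [Finset.sum_add_distrib, Finset.sum_add_distrib, ← Finset.mul_sum, ← Finset.mul_sum,
      Finset.sum_const, Finset.card_range, nsmul_eq_mul] at hs
    calc _ ≤ _ := div_le_div_of_nonneg_right hs hn'.le
      _ = _ := by field_simp
  have hc0 : ∀ k, 1 ≤ c k := fun k => by
    refine ge_of_tendsto (hc k) ?_
    filter_upwards [eventually_gt_atTop 0] with n hn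
    have hn' : (0 : ℝ) < n := by exact_mod_cast hn
    rw [le_div_iff₀ hn']
    refine le_trans ?_ (Finset.card_nsmul_le_sum _ _ 1 fun i _ =>
      one_le_mul_of_one_le_of_one_le (h1 i) (h1 (i - k)))
    simp
  have hsm := (summable_geometric_succ hr0 hr1).mul_right (L ^ 2 + 1)
  have hT0 : 0 ≤ ∑' k : ℕ, r ^ (k + 1) * c (k + 1) :=
    tsum_nonneg fun k => mul_nonneg (by positivity) (zero_le_one.trans (hc0 _))
  have hT1 : ∑' k : ℕ, r ^ (k + 1) * c (k + 1) ≤ r / (1 - r) * (L ^ 2 + 1) := by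
    rw [← tsum_geometric_succ hr0 hr1, ← tsum_mul_right]
    have hle : ∀ k : ℕ, r ^ (k + 1) * c (k + 1) ≤ r ^ (k + 1) * (L ^ 2 + 1) :=
      fun k => mul_le_mul_of_nonneg_left (hcle _) (by positivity)
    exact (hsm.of_nonneg_of_le (fun k => mul_nonneg (by positivity)
      (zero_le_one.trans (hc0 _))) hle).tsum_le_tsum hle hsm
  have hpos : 0 < c 0 + 2 * ∑' k : ℕ, r ^ (k + 1) * c (k + 1) := by linarith [hc0 0]
  refine ⟨_, hasSpeed_of_gap_correlations hp hp1 hx hM hω hLpos hL hc hpos, ?_⟩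
  have hκ : c 0 + 2 * ∑' k : ℕ, r ^ (k + 1) * c (k + 1) ≤ (L ^ 2 + 1) / (2 * p - 1) := by
    -- `1 + 2 r / (1 - r) = (1 + r) / (1 - r) = 1 / (2 p - 1)`.
    have e : (L ^ 2 + 1) / (2 * p - 1) = (L ^ 2 + 1) + 2 * (r / (1 - r) * (L ^ 2 + 1)) := by
      have h2 : 2 * p - 1 ≠ 0 := by linarith
      have h3 : 1 - r = (2 * p - 1) / p := by rw [hr]; field_simp; ring
      rw [h3, hr]
      field_simp
      ring
    rw [e]
    linarith [hcle 0]
  calc (2 * p - 1) * (L / (L ^ 2 + 1)) = L / ((L ^ 2 + 1) / (2 * p - 1)) := by field_simp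
    _ ≤ _ := div_le_div_of_nonneg_left hLpos.le hpos hκ
end

/-! ### Environments with prescribed drift points. -/

noncomputable section

open scoped Classical in
/-- The environment with value `p` at the points of `x` and value `1 / 2` elsewhere. -/
def driftEnvironment {p : ℝ} (hp : 1 / 2 < p) (hp1 : p ≤ 1) (x : ℤ → ℤ) : Environment := fun z =>
  if z ∈ Set.range x then ⟨p, by linarith, hp1⟩ else ⟨1 / 2, by norm_num, by norm_num⟩

section DriftEnvironment

variable {p : ℝ} (hp : 1 / 2 < p) (hp1 : p ≤ 1) (x : ℤ → ℤ)

lemma driftEnvironment_apply (z : ℤ) :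
    (z ∈ Set.range x → (driftEnvironment hp hp1 x z : ℝ) = p) ∧
      (z ∉ Set.range x → (driftEnvironment hp hp1 x z : ℝ) = 1 / 2) :=
  ⟨fun h => by rw [driftEnvironment, if_pos h], fun h => by rw [driftEnvironment, if_neg h]⟩

lemma driftEnvironment_eq_iff (z : ℤ) :
    (driftEnvironment hp hp1 x z : ℝ) = p ↔ z ∈ Set.range x := by
  refine ⟨fun h => ?_, (driftEnvironment_apply hp hp1 x z).1⟩
  by_contra hz
  rw [(driftEnvironment_apply hp hp1 x z).2 hz] at h
  linarith

variable {x}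

lemma isEnvironment_driftEnvironment {L : ℝ} (hx : StrictMono x) (hLpos : 0 < L)
    (hgap : ∀ i, |gap x i - L| ≤ 1) (hL : Tendsto (fun n : ℕ => (x n : ℝ) / n) atTop (𝓝 L)) :
    IsEnvironment p L⁻¹ (driftEnvironment hp hp1 x) where
  values z := by
    by_cases hz : z ∈ Set.range x
    · exact Or.inr ((driftEnvironment_apply hp hp1 x z).1 hz)
    · exact Or.inl ((driftEnvironment_apply hp hp1 x z).2 hz)
  density := by
    have : {y : ℤ | (driftEnvironment hp hp1 x y : ℝ) = p} = Set.range x :=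
      Set.ext fun z => driftEnvironment_eq_iff hp hp1 x z
    rw [this]
    refine limsup_density_range hx (M := L + 1) (fun i => ?_) hLpos hL
    have := (abs_le.1 (hgap i)).2
    unfold gap at this
    linarith

end DriftEnvironment

/-- The positions of spaced drifts of density `lam` with offset `c`. -/
def spacedPoint (c lam : ℝ) (i : ℤ) : ℤ := ⌈((i : ℝ) + c) / lam⌉

/-! ### Spaced drifts of rational density. -/

section Spaced

variable {c lam : ℝ}

lemma strictMono_spacedPoint (h0 : 0 < lam) (h1 : lam ≤ 1) : StrictMono (spacedPoint c lam) := by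
  refine strictMono_int_of_lt_succ fun i => ?_
  rw [← Int.add_one_le_iff, spacedPoint, spacedPoint, ← Int.ceil_add_one]
  refine Int.ceil_mono ?_
  have : 1 ≤ 1 / lam := (one_le_div h0).2 h1
  push_cast
  rw [show ((i : ℝ) + 1 + c) / lam = (i + c) / lam + 1 / lam by ring]
  linarith

lemma abs_gap_spacedPoint_sub_le (i : ℤ) : |gap (spacedPoint c lam) i - lam⁻¹| ≤ 1 := by
  unfold gap spacedPoint
  have e : (((i + 1 : ℤ) : ℝ) + c) / lam = (i + c) / lam + lam⁻¹ := by push_cast; ring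
  have a1 := Int.le_ceil (((i : ℝ) + c) / lam)
  have a2 := Int.ceil_lt_add_one (((i : ℝ) + c) / lam)
  have b1 := Int.le_ceil ((((i + 1 : ℤ) : ℝ) + c) / lam)
  have b2 := Int.ceil_lt_add_one ((((i + 1 : ℤ) : ℝ) + c) / lam)
  rw [abs_le]
  constructor <;> linarith

lemma tendsto_spacedPoint_div :
    Tendsto (fun n : ℕ => (spacedPoint c lam n : ℝ) / n) atTop (𝓝 lam⁻¹) := by
  have := (tendsto_bounded_div_atTop (b := fun n : ℕ => (spacedPoint c lam n : ℝ) - n * lam⁻¹)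
    (B := |c / lam| + 1) fun n => ?_).add_const lam⁻¹
  · rw [zero_add] at this
    refine this.congr' ?_
    filter_upwards [eventually_gt_atTop 0] with n hn
    have : (n : ℝ) ≠ 0 := by positivity
    rw [sub_div, mul_div_cancel_left₀ _ this, sub_add_cancel]
  · unfold spacedPoint
    have e : (((n : ℤ) : ℝ) + c) / lam = n * lam⁻¹ + c / lam := by push_cast; ring
    have a1 := Int.le_ceil ((((n : ℤ) : ℝ) + c) / lam)
    have a2 := Int.ceil_lt_add_one ((((n : ℤ) : ℝ) + c) / lam)
    have a3 := neg_abs_le (c / lam)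
    have a4 := le_abs_self (c / lam)
    rw [abs_le]
    constructor <;> linarith

/-- Since `q.num / q = q.den` is an integer, shifting the index by `q.num` moves the point by
exactly `q.den`, ceiling included. -/
lemma periodic_gap_spacedPoint {q : ℚ} (hq : 0 < q) :
    Function.Periodic (gap (spacedPoint c q)) (q.num.toNat : ℤ) := by
  have hnum : ((q.num.toNat : ℕ) : ℤ) = q.num := Int.toNat_of_nonneg (Rat.num_pos.2 hq).le
  have h : ∀ i, spacedPoint c q (i + q.num) = spacedPoint c q i + q.den := fun i => by
    unfold spacedPoint
    rw [← Int.ceil_add_natCast]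
    congr 1
    have h1 : (q : ℝ) ≠ 0 := by exact_mod_cast hq.ne'
    have h2 : (q.num : ℝ) = q * q.den := by exact_mod_cast (Rat.mul_den_eq_num q).symm
    push_cast
    rw [h2]
    field_simp
    ring
  intro i
  rw [hnum]
  unfold gap
  rw [add_right_comm, h, h]
  push_cast
  ring

lemma exists_tendsto_correlation_spacedPoint {q : ℚ} (hq : 0 < q) (k : ℕ) :
    ∃ a, Tendsto (fun n : ℕ => (∑ i ∈ Finset.range n, gap (spacedPoint c q) i *
      gap (spacedPoint c q) (i - k)) / n) atTop (𝓝 a) := by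
  have hpos : 0 < q.num.toNat := by have := Rat.num_pos.2 hq; omega
  refine exists_tendsto_cesaro_of_periodic (v := fun i : ℕ => gap (spacedPoint c q) i *
      gap (spacedPoint c q) (i - k)) hpos fun i => ?_
  have h := periodic_gap_spacedPoint (c := c) hq
  simp only [Nat.cast_add]
  rw [h, add_sub_right_comm, h]

/-- A spaced environment of rational density has a speed, with a cubic lower bound. -/
theorem exists_spaced_environment {p : ℝ} (hp : 1 / 2 < p) (hp1 : p ≤ 1) {q : ℚ} (hq : 0 < q)
    (hq1 : (q : ℝ) ≤ 1) :
    ∃ ω : Environment, IsEnvironment p q ω ∧ HasSpacedDrifts p q ω ∧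
      ∃ v, HasSpeed ω v ∧ (2 * p - 1) * ((q : ℝ)⁻¹ / ((q : ℝ)⁻¹ ^ 2 + 1)) ≤ v := by
  have hq0 : (0 : ℝ) < q := by exact_mod_cast hq
  set x := spacedPoint ((1 - p) / (2 * p - 1)) q with hxdef
  have hx : StrictMono x := strictMono_spacedPoint hq0 hq1
  refine ⟨driftEnvironment hp hp1 x, ?_, fun z => ?_,
    exists_hasSpeed_ge hp hp1 hx (inv_pos.2 hq0) abs_gap_spacedPoint_sub_le
      (driftEnvironment_apply hp hp1 x) tendsto_spacedPoint_div
      (exists_tendsto_correlation_spacedPoint hq)⟩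
  · have := isEnvironment_driftEnvironment hp hp1 hx (inv_pos.2 hq0) abs_gap_spacedPoint_sub_le
      tendsto_spacedPoint_div
    rwa [inv_inv] at this
  · rw [driftEnvironment_eq_iff]
    exact exists_congr fun i => eq_comm

end Spaced

/-! ### Gaps in long runs, for an arbitrary density. -/

section Blocks

/-- The length of the run of ones in the block `[N ^ 2, (N + 1) ^ 2)`. -/
def runLength (θ : ℝ) (N : ℕ) : ℕ := ⌊θ * ((N + 1 : ℕ) : ℝ) ^ 2⌋₊ - ⌊θ * (N : ℝ) ^ 2⌋₊

/-- A count with limiting frequency `θ` whose unit increments are arranged, in each block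
`[N ^ 2, (N + 1) ^ 2)`, in one run at the beginning of the block. -/
def blockCount (θ : ℝ) (n : ℕ) : ℕ :=
  ⌊θ * (n.sqrt : ℝ) ^ 2⌋₊ + min (n - n.sqrt * n.sqrt) (runLength θ n.sqrt)

variable {θ : ℝ}

lemma floor_sq_le_succ (h0 : 0 ≤ θ) (N : ℕ) :
    ⌊θ * (N : ℝ) ^ 2⌋₊ ≤ ⌊θ * ((N + 1 : ℕ) : ℝ) ^ 2⌋₊ :=
  Nat.floor_mono (by push_cast; gcongr; linarith)

/-- The block `[N ^ 2, (N + 1) ^ 2)` has `2 * N + 1` elements, so its run of ones fits inside it. -/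
lemma floor_sq_succ_le (h0 : 0 ≤ θ) (h1 : θ ≤ 1) (N : ℕ) :
    ⌊θ * ((N + 1 : ℕ) : ℝ) ^ 2⌋₊ ≤ ⌊θ * (N : ℝ) ^ 2⌋₊ + (2 * N + 1) := by
  rw [← Nat.floor_add_natCast (by positivity)]
  refine Nat.floor_mono ?_
  push_cast
  nlinarith [(N.cast_nonneg : (0 : ℝ) ≤ N)]

lemma blockCount_succ (h0 : 0 ≤ θ) (h1 : θ ≤ 1) (n : ℕ) :
    blockCount θ (n + 1) = blockCount θ n +
      if n - n.sqrt * n.sqrt < runLength θ n.sqrt then 1 else 0 := by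
  obtain ⟨N, j, hj, rfl⟩ : ∃ N j, j ≤ N + N ∧ n = N * N + j :=
    ⟨n.sqrt, n - n.sqrt * n.sqrt, by have := n.sqrt_le_add; omega,
      by have := n.sqrt_le; omega⟩
  have a1 := floor_sq_le_succ h0 N
  have a2 := floor_sq_succ_le h0 h1 N
  have e1 : (N * N + j).sqrt = N := Nat.sqrt_add_eq N hj
  unfold blockCount runLength
  rw [e1]
  -- Either `n + 1` lies in the same block, or `j = N + N` and `n + 1` opens the next one, where the
  -- run has been completed.
  rcases hj.lt_or_eq with hlt | heq
  · have e2 : (N * N + j + 1).sqrt = N := by rw [add_assoc]; exact Nat.sqrt_add_eq N hlt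
    rw [e2]
    split_ifs <;> omega
  · have e3 : N * N + j + 1 = (N + 1) * (N + 1) := by rw [heq]; ring
    rw [e3, Nat.sqrt_eq]
    split_ifs <;> omega

lemma blockCount_le (h0 : 0 ≤ θ) (n : ℕ) :
    blockCount θ n ≤ ⌊θ * ((n.sqrt + 1 : ℕ) : ℝ) ^ 2⌋₊ := by
  have := floor_sq_le_succ h0 n.sqrt
  unfold blockCount runLength
  omega

lemma tendsto_blockCount_div (h0 : 0 ≤ θ) (h1 : θ ≤ 1) :
    Tendsto (fun n : ℕ => (blockCount θ n : ℝ) / n) atTop (𝓝 θ) := by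
  have hs : Tendsto (fun n : ℕ => 4 / (n.sqrt : ℝ)) atTop (𝓝 0) :=
    (tendsto_const_div_atTop_nhds_zero_nat 4).comp (tendsto_atTop.2 fun b => by
      filter_upwards [eventually_ge_atTop (b * b)] with n hn
      exact Nat.le_sqrt.2 hn)
  have h2 : Tendsto (fun n : ℕ => (blockCount θ n : ℝ) / n - θ) atTop (𝓝 0) := by
    refine squeeze_zero_norm' ?_ hs
    filter_upwards [eventually_gt_atTop 0] with n hn
    have hn' : (0 : ℝ) < n := by exact_mod_cast hn
    set N := n.sqrt with hN
    have hNpos : 1 ≤ N := Nat.sqrt_pos.2 hn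
    have hN1 : (1 : ℝ) ≤ N := by exact_mod_cast hNpos
    have b1 : (N : ℝ) ^ 2 ≤ n := by have := n.sqrt_le; rw [sq]; exact_mod_cast this
    have b2 : (n : ℝ) ≤ N ^ 2 + 2 * N := by
      have := n.sqrt_le_add
      have : (n : ℝ) ≤ N * N + N + N := by exact_mod_cast this
      linarith
    have c1 : ⌊θ * (N : ℝ) ^ 2⌋₊ ≤ blockCount θ n := Nat.le_add_right _ _
    have c2 : blockCount θ n ≤ ⌊θ * ((N + 1 : ℕ) : ℝ) ^ 2⌋₊ := blockCount_le h0 n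
    have d1 : θ * (N : ℝ) ^ 2 - 1 ≤ blockCount θ n :=
      (Nat.sub_one_lt_floor _).le.trans (by exact_mod_cast c1)
    have d2 : (blockCount θ n : ℝ) ≤ θ * ((N : ℝ) + 1) ^ 2 := by
      have : (blockCount θ n : ℝ) ≤ ⌊θ * ((N + 1 : ℕ) : ℝ) ^ 2⌋₊ := by exact_mod_cast c2
      refine this.trans ((Nat.floor_le (by positivity)).trans_eq ?_)
      push_cast; ring
    have e : (blockCount θ n : ℝ) / n - θ = (blockCount θ n - θ * n) / n := by
      field_simp
    -- Both quantities lie within a block-sized error of `θ * N ^ 2`; dividing by `n ≥ N ^ 2` leaves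
    -- at most `4 / N`.
    have hup : |(blockCount θ n : ℝ) - θ * n| ≤ 4 * N := by
      rw [abs_le]
      constructor <;> nlinarith
    rw [e, Real.norm_eq_abs, abs_div, abs_of_pos hn', div_le_div_iff₀ hn' (by linarith)]
    nlinarith
  simpa using h2.add_const θ

/-- The increments of `blockCount`. -/
def blockIncr (θ : ℝ) (n : ℕ) : ℝ :=
  if n - n.sqrt * n.sqrt < runLength θ n.sqrt then 1 else 0

lemma blockIncr_eq_zero_or_one (n : ℕ) : blockIncr θ n = 0 ∨ blockIncr θ n = 1 := by
  unfold blockIncr; split_ifs <;> simp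

lemma blockIncr_eq (h0 : 0 ≤ θ) (h1 : θ ≤ 1) (n : ℕ) :
    blockIncr θ n = blockCount θ (n + 1) - blockCount θ n := by
  rw [blockCount_succ h0 h1, blockIncr]
  push_cast
  ring

/-- Within a block the only possible jump is from 1 to 0, and the potential `1 - blockIncr θ n` pays
for it. Entering a new block raises `n.sqrt` by one, which covers any jump there and the change of
the potential. -/
lemma sum_abs_blockIncr_sub_le (n : ℕ) :
    ∑ i ∈ Finset.range n, |blockIncr θ (i + 1) - blockIncr θ i| ≤
      2 * n.sqrt + (1 - blockIncr θ n) := by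
  induction n with
  | zero => rcases blockIncr_eq_zero_or_one (θ := θ) 0 with h | h <;> simp [h]
  | succ n ih =>
    rw [Finset.sum_range_succ]
    have hmono : n.sqrt ≤ (n + 1).sqrt := Nat.sqrt_le_sqrt (Nat.le_succ n)
    rcases hmono.lt_or_eq with hlt | heq
    · have : (n.sqrt : ℝ) + 1 ≤ (n + 1).sqrt := by exact_mod_cast hlt
      have habs : |blockIncr θ (n + 1) - blockIncr θ n| ≤
          2 + blockIncr θ n - blockIncr θ (n + 1) := by
        rcases blockIncr_eq_zero_or_one (θ := θ) n with h | h <;>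
          rcases blockIncr_eq_zero_or_one (θ := θ) (n + 1) with h' | h' <;>
          rw [h, h'] <;> norm_num
      linarith
    · have hle : blockIncr θ (n + 1) ≤ blockIncr θ n := by
        unfold blockIncr
        rw [← heq]
        split_ifs <;> first | omega | norm_num
      rw [abs_of_nonpos (by linarith), ← heq]
      linarith

lemma tendsto_sqrt_div : Tendsto (fun n : ℕ => (2 * (n.sqrt : ℝ) + 1) / n) atTop (𝓝 0) := by
  have hs : Tendsto (fun n : ℕ => 3 / (n.sqrt : ℝ)) atTop (𝓝 0) :=
    (tendsto_const_div_atTop_nhds_zero_nat 3).comp (tendsto_atTop.2 fun b => by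
      filter_upwards [eventually_ge_atTop (b * b)] with n hn
      exact Nat.le_sqrt.2 hn)
  refine squeeze_zero' (Eventually.of_forall fun n => by positivity) ?_ hs
  filter_upwards [eventually_gt_atTop 0] with n hn
  have hN1 : (1 : ℝ) ≤ n.sqrt := by exact_mod_cast Nat.sqrt_pos.2 hn
  have hn' : (0 : ℝ) < n := by exact_mod_cast hn
  have b1 : (n.sqrt : ℝ) * n.sqrt ≤ n := by exact_mod_cast n.sqrt_le
  rw [div_le_div_iff₀ hn' (by linarith)]
  nlinarith

/-- Positions with gaps `m` and `m + 1`, arranged in long runs, with mean gap `m + θ`. -/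
def blockPoint (m : ℕ) (θ : ℝ) (i : ℤ) : ℤ := m * i + blockCount θ i.toNat

variable {m : ℕ}

lemma gap_blockPoint_natCast (h0 : 0 ≤ θ) (h1 : θ ≤ 1) (n : ℕ) :
    gap (blockPoint m θ) n = m + blockIncr θ n := by
  have e : ((n : ℤ) + 1).toNat = n + 1 := by omega
  rw [blockIncr_eq h0 h1, gap, blockPoint, blockPoint, e, Int.toNat_natCast]
  push_cast; ring

lemma gap_blockPoint_of_neg {i : ℤ} (hi : i < 0) : gap (blockPoint m θ) i = m := by
  have e1 : (i + 1).toNat = 0 := by omega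
  have e2 : i.toNat = 0 := by omega
  rw [gap, blockPoint, blockPoint, e1, e2]
  push_cast; ring

lemma gap_blockPoint_mem (h0 : 0 ≤ θ) (h1 : θ ≤ 1) (i : ℤ) :
    gap (blockPoint m θ) i = m ∨ gap (blockPoint m θ) i = m + 1 := by
  rcases lt_or_ge i 0 with hi | hi
  · exact Or.inl (gap_blockPoint_of_neg hi)
  · obtain ⟨n, rfl⟩ := Int.eq_ofNat_of_zero_le hi
    rw [gap_blockPoint_natCast h0 h1]
    rcases blockIncr_eq_zero_or_one (θ := θ) n with h | h <;> simp [h]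

lemma strictMono_blockPoint (h0 : 0 ≤ θ) (h1 : θ ≤ 1) (hm : 1 ≤ m) :
    StrictMono (blockPoint m θ) := by
  refine strictMono_int_of_lt_succ fun i => ?_
  have hm' : (1 : ℝ) ≤ m := by exact_mod_cast hm
  have : 0 < gap (blockPoint m θ) i := by
    rcases gap_blockPoint_mem (m := m) h0 h1 i with h | h <;> rw [h] <;> linarith
  unfold gap at this
  exact_mod_cast sub_pos.1 this

lemma tendsto_blockPoint_div (h0 : 0 ≤ θ) (h1 : θ ≤ 1) :
    Tendsto (fun n : ℕ => (blockPoint m θ n : ℝ) / n) atTop (𝓝 (m + θ)) := by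
  refine ((tendsto_blockCount_div h0 h1).const_add (m : ℝ)).congr' ?_
  filter_upwards [eventually_gt_atTop 0] with n hn
  have : (n : ℝ) ≠ 0 := by positivity
  rw [blockPoint, Int.toNat_natCast]
  push_cast
  field_simp

lemma exists_tendsto_correlation_blockPoint (h0 : 0 ≤ θ) (h1 : θ ≤ 1) (k : ℕ) :
    ∃ a, Tendsto (fun n : ℕ => (∑ i ∈ Finset.range n, gap (blockPoint m θ) i *
      gap (blockPoint m θ) (i - k)) / n) atTop (𝓝 a) := by
  have hmem := gap_blockPoint_mem (m := m) h0 h1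
  have hmean := tendsto_cesaro_gap (tendsto_blockPoint_div (m := m) h0 h1)
  have hm0 : (0 : ℝ) ≤ m := m.cast_nonneg
  -- A gap `u` in `{m, m + 1}` satisfies `u ^ 2 = (2 m + 1) u - m (m + 1)`, so the mean `m + θ`
  -- determines the mean square.
  refine ⟨(2 * m + 1) * (m + θ) - m * (m + 1), tendsto_correlation_of_few_jumps (M := m + 1)
    (fun i => ?_) ?_ ?_ k⟩
  · rcases hmem i with h | h <;> rw [h, abs_of_nonneg (by linarith)]
    linarith
  · refine ((hmean.const_mul (2 * (m : ℝ) + 1)).sub_const ((m : ℝ) * (m + 1))).congr' ?_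
    filter_upwards [eventually_gt_atTop 0] with n hn
    have hn' : (n : ℝ) ≠ 0 := by positivity
    have e : ∀ i : ℤ, gap (blockPoint m θ) i * gap (blockPoint m θ) i =
        (2 * m + 1) * gap (blockPoint m θ) i - m * (m + 1) := fun i => by
      rcases hmem i with h | h <;> rw [h] <;> ring
    simp_rw [e]
    rw [Finset.sum_sub_distrib, ← Finset.mul_sum, Finset.sum_const, Finset.card_range,
      nsmul_eq_mul]
    field_simp
  · refine squeeze_zero (fun n => by positivity) (fun n => ?_) tendsto_sqrt_div
    gcongr
    refine le_trans (le_of_eq ?_) ((sum_abs_blockIncr_sub_le (θ := θ) n).trans ?_)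
    · refine Finset.sum_congr rfl fun i _ => ?_
      have := gap_blockPoint_natCast (m := m) h0 h1 (i + 1)
      rw [Nat.cast_succ] at this
      rw [this, gap_blockPoint_natCast h0 h1, add_sub_add_left_eq_sub]
    · rcases blockIncr_eq_zero_or_one (θ := θ) n with h | h <;> rw [h] <;> linarith

/-- For every density there is an environment with a speed and a cubic lower bound on it. -/
theorem exists_block_environment {p : ℝ} (hp : 1 / 2 < p) (hp1 : p ≤ 1) {lam : ℝ} (hl : 0 < lam)
    (hl1 : lam ≤ 1) :
    ∃ ω : Environment, IsEnvironment p lam ω ∧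
      ∃ v, HasSpeed ω v ∧ (2 * p - 1) * (lam⁻¹ / (lam⁻¹ ^ 2 + 1)) ≤ v := by
  have hL : 1 ≤ lam⁻¹ := (one_le_inv₀ hl).2 hl1
  set m := ⌊lam⁻¹⌋₊ with hm
  set θ := lam⁻¹ - m with hθ
  have h0 : 0 ≤ θ := sub_nonneg.2 (Nat.floor_le (by linarith))
  have h1 : θ ≤ 1 := by have := Nat.lt_floor_add_one lam⁻¹; rw [← hm] at this; linarith
  have hm1 : 1 ≤ m := Nat.one_le_floor_iff _ |>.2 hL
  have e : (m : ℝ) + θ = lam⁻¹ := by rw [hθ]; ring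
  have hx := strictMono_blockPoint h0 h1 hm1
  have hgap : ∀ i, |gap (blockPoint m θ) i - lam⁻¹| ≤ 1 := fun i => by
    rw [← e, abs_le]
    rcases gap_blockPoint_mem (m := m) h0 h1 i with h | h <;> rw [h] <;>
      constructor <;> linarith
  have hlim := tendsto_blockPoint_div (m := m) h0 h1
  rw [e] at hlim
  refine ⟨driftEnvironment hp hp1 (blockPoint m θ), ?_,
    exists_hasSpeed_ge hp hp1 hx (inv_pos.2 hl) hgap (driftEnvironment_apply hp hp1 _) hlim
      (exists_tendsto_correlation_blockPoint h0 h1)⟩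
  have := isEnvironment_driftEnvironment hp hp1 hx (inv_pos.2 hl) hgap hlim
  rwa [inv_inv] at this

end Blocks

/-- The right side is `l / (1 + l ^ 2)`, and `(l - l ^ 3) * (1 + l ^ 2) = l - l ^ 5`. -/
lemma sub_pow_three_le_inv_div {l : ℝ} (hl : 0 < l) : l - l ^ 3 ≤ l⁻¹ / (l⁻¹ ^ 2 + 1) := by
  have : l⁻¹ / (l⁻¹ ^ 2 + 1) = l / (1 + l ^ 2) := by field_simp
  rw [this, le_div_iff₀ (by positivity)]
  nlinarith [pow_pos hl 5]
end

theorem proposition1p5 (p : ℝ) (hp : 1 / 2 < p) (hp1 : p ≤ 1) :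
    ∃ D : ℝ, 0 < D ∧ ∀ lam : ℝ, 0 < lam → lam ≤ 1 →
      (∃ ω : Environment, IsEnvironment p lam ω ∧
        ((∃ q : ℚ, lam = (q : ℝ)) → HasSpacedDrifts p lam ω) ∧
        ∃ v : ℝ, HasSpeed ω v ∧ (2 * p - 1) * lam - D * lam ^ 3 ≤ v) ∧
      (Irrational lam → ∃ ε : ℝ, 0 < ε ∧ ∀ q : ℚ, 0 < q → lam - ε < (q : ℝ) → (q : ℝ) < lam →
        ∃ ω : Environment, IsEnvironment p (q : ℝ) ω ∧ HasSpacedDrifts p (q : ℝ) ω ∧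
          ∃ v : ℝ, HasSpeed ω v ∧ (2 * p - 1) * lam - D * lam ^ 3 ≤ v) := by
  have hc0 : 0 ≤ 2 * p - 1 := by linarith
  have hc1 : 2 * p - 1 ≤ 1 := by linarith
  -- One `lam ^ 3` pays for the speed bound, the other for replacing `lam` by a nearby rational; `2
  -- * p - 1 ≤ 1` makes the constant uniform in `p`.
  refine ⟨2, two_pos, fun lam hl hl1 => ?_⟩
  have h3 : 0 < lam ^ 3 := by positivity
  have hbound : (2 * p - 1) * lam - 2 * lam ^ 3 ≤
      (2 * p - 1) * (lam⁻¹ / (lam⁻¹ ^ 2 + 1)) := by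
    have := mul_le_mul_of_nonneg_left (sub_pow_three_le_inv_div hl) hc0
    nlinarith
  -- With `ε = lam ^ 3`, the density `q` falls short of `lam` by less than `lam ^ 3`.
  refine ⟨?_, fun _ => ⟨lam ^ 3, h3, fun q hq hlow hup => ?_⟩⟩
  · by_cases hrat : ∃ q : ℚ, lam = (q : ℝ)
    · obtain ⟨q, rfl⟩ := hrat
      obtain ⟨ω, h1, h2, v, hv, hle⟩ := exists_spaced_environment hp hp1 (Rat.cast_pos.1 hl) hl1
      exact ⟨ω, h1, fun _ => h2, v, hv, hbound.trans hle⟩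
    · obtain ⟨ω, h1, v, hv, hle⟩ := exists_block_environment hp hp1 hl hl1
      exact ⟨ω, h1, fun h => absurd h hrat, v, hv, hbound.trans hle⟩
  · obtain ⟨ω, h1, h2, v, hv, hle⟩ := exists_spaced_environment hp hp1 hq (hup.le.trans hl1)
    refine ⟨ω, h1, h2, v, hv, le_trans ?_ hle⟩
    have hq0 : (0 : ℝ) < q := Rat.cast_pos.2 hq
    have hq3 : (q : ℝ) ^ 3 ≤ lam ^ 3 := pow_le_pow_left₀ hq0.le hup.le 3
    have e1 := mul_le_mul_of_nonneg_left (sub_pow_three_le_inv_div hq0) hc0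
    have e2 : lam - 2 * lam ^ 3 ≤ (q : ℝ) - q ^ 3 := by linarith
    have e3 := mul_le_mul_of_nonneg_left e2 hc0
    nlinarith
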